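/- For integers $n\ge 2$ and $k_1,\dots,k_n\ge 2$, a \emph{game} with player set $[n]=\{1,\dots,n\}$ and action sets $[k_1],\dots,[k_n]$ consists of a complete and transitive preference relation $\succsim_i$ on the set $A=\prod_{j}[k_j]$ of action profiles for each player $i$; write $\succ_i$ for its asymmetric part. The game is \emph{generic} if for every $i$ and all distinct $a,a'\in A$ that differ only in coordinate $i$, either $a\succ_i a'$ or $a'\succ_i a$. An action $x\in[k_i]$ is a \emph{best-response} of player $i$ to $a_{-i}$ if $(x,a_{-i})\succsim_i(y,a_{-i})$ for all $y\in[k_i]$, and $a\in A$ is a \emph{pure Nash equilibrium} if $a_i$ is a best-response to $a_{-i}$ for every $i$. The \emph{best-response graph} has vertex set $A$ and an edge $a\to b$ if and only if, for some $i$, $a_{-i}=b_{-i}$, $b_i$ is a best-response to $a_{-i}$, and $b\succ_i a$. The game is \emph{connected} if this graph has at least one sink (vertex without outgoing edges) and every vertex that is not a sink can reach every sink along a directed path. Let $\mathcal N(n,\mathbf k)$ be the (finite) set of generic games with player set $[n]$ and action sets $[k_1],\dots,[k_n]$ that have a pure Nash equilibrium. There is a universal constant $\delta>0$ such that the following holds.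 For each $n$ let $\mathbf k=\mathbf k^{(n)}\in\{2,3,\dots\}^n$ (possibly depending on $n$), with $\max_i k^{(n)}_i\le\delta\sqrt{n/\log n}$ for all sufficiently large $n$, and let $\mathcal X(n,\mathbf k)\subseteq\mathcal N(n,\mathbf k)$ be a class of games with positive asymptotic density, that is, there is $p\in(0,1]$ such that $|\mathcal X(n,\mathbf k)|/|\mathcal N(n,\mathbf k)|\ge p$ for all sufficiently large $n$. Then $$\frac{|\{g\in\mathcal X(n,\mathbf k): g\text{ is connected}\}|}{|\mathcal X(n,\mathbf k)|}\longrightarrow 1\qquad\text{as } n\to\infty.$$ -/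

import Mathlib

open Filter Topology

/-- Action profiles: player `i : Fin n` has the action set `Fin (k i)`. -/
abbrev ActionProfile (n : ℕ) (k : Fin n → ℕ) : Type := (i : Fin n) → Fin (k i)

/-- An ordinal game with player set `Fin n` and action sets `Fin (k i)`: each player has a
complete and transitive preference relation on the action profiles. `pref i a b` reads
"player `i` weakly prefers `a` to `b`". -/
structure Game (n : ℕ) (k : Fin n → ℕ) where
  pref : Fin n → ActionProfile n k → ActionProfile n k → Prop
  pref_total : ∀ i a b, pref i a b ∨ pref i b a
  pref_trans : ∀ i a b c, pref i a b → pref i b c → pref i a c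

/-- For fixed numbers of players and actions there are finitely many games, so that
cardinalities of sets of games may be measured by `Set.ncard`. -/
instance Game.instFinite (n : ℕ) (k : Fin n → ℕ) : Finite (Game n k) :=
  Finite.of_injective (fun g : Game n k => g.pref) (by
    rintro ⟨p, _, _⟩ ⟨q, _, _⟩ h
    cases h
    rfl)

namespace Game

variable {n : ℕ} {k : Fin n → ℕ}

/-- The asymmetric part of player `i`'s preference relation. -/
def StrictPref (g : Game n k) (i : Fin n) (a b : ActionProfile n k) : Prop :=
  g.pref i a b ∧ ¬ g.pref i b a

/-- Action `x` of player `i` is a best-response to `a₋ᵢ` (the `i`th coordinate of `a` plays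
no role). -/
def IsBestResponse (g : Game n k) (i : Fin n) (x : Fin (k i)) (a : ActionProfile n k) : Prop :=
  ∀ y : Fin (k i), g.pref i (Function.update a i x) (Function.update a i y)

/-- The profile `a` is a pure Nash equilibrium. -/
def IsPureNash (g : Game n k) (a : ActionProfile n k) : Prop :=
  ∀ i, g.IsBestResponse i (a i) a

/-- The best-response graph: `a → b` iff, for some player `i`, `a₋ᵢ = b₋ᵢ`, `bᵢ` is a
best-response to `a₋ᵢ`, and `i` strictly prefers `b` to `a`. -/
def bestResponseGraph (g : Game n k) : Digraph (ActionProfile n k) where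
  Adj a b := ∃ i, (∀ j, j ≠ i → a j = b j) ∧ g.IsBestResponse i (b i) a ∧ g.StrictPref i b a

/-- A game is generic if no player is indifferent between two distinct profiles that differ
only in that player's own action. -/
def IsGeneric (g : Game n k) : Prop :=
  ∀ (i : Fin n) (a b : ActionProfile n k), a ≠ b → (∀ j, j ≠ i → a j = b j) →
    g.StrictPref i a b ∨ g.StrictPref i b a

end Game

/-- A vertex of a directed graph is a sink if it has no outgoing edges. -/
def Digraph.IsSinkVertex {V : Type*} (G : Digraph V) (v : V) : Prop :=
  ∀ w, ¬ G.Adj v w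

/-- `v` can reach `w` along directed edges (every vertex reaches itself). -/
def Digraph.CanReach {V : Type*} (G : Digraph V) (v w : V) : Prop :=
  Relation.ReflTransGen G.Adj v w

/-- A game is connected if its best-response graph has at least one sink and every non-sink
can reach every sink. -/
def Game.IsConnected {n : ℕ} {k : Fin n → ℕ} (g : Game n k) : Prop :=
  (∃ v, g.bestResponseGraph.IsSinkVertex v) ∧
    ∀ v w, ¬ g.bestResponseGraph.IsSinkVertex v → g.bestResponseGraph.IsSinkVertex w →
      g.bestResponseGraph.CanReach v w

/-- The set of generic games with the given players and actions that have a pure Nash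
equilibrium. -/
def genericNashGames (n : ℕ) (k : Fin n → ℕ) : Set (Game n k) :=
  {g | g.IsGeneric ∧ ∃ a, g.IsPureNash a}

/-- Positive asymptotic density, among generic games with a pure Nash equilibrium, of a class
of games `X n` with `n` players and numbers of actions `k n`. -/
def HasPositiveAsymptoticDensity (k : (n : ℕ) → Fin n → ℕ)
    (X : (n : ℕ) → Set (Game n (k n))) : Prop :=
  ∃ p : ℝ, 0 < p ∧ p ≤ 1 ∧
    ∀ᶠ n : ℕ in atTop, p ≤ ((X n).ncard : ℝ) / ((genericNashGames n (k n)).ncard : ℝ)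

/-! The best-response graph of a generic game is determined by the winner of each grid line, and
relabelling actions line by line shows that these winners are independent and uniform. It remains to
show that a random choice of winners has, with high probability, no sink `w` that some non-sink
misses. A sink exists with probability at least 1/2 (second moment), so conditioning on one costs a
factor 2, and passing to a class of density `p` a factor `1/p`.

Local moves: a coordinate can be changed at will by deviating in another direction `m`, moving, and
undoing the deviation. Each `m` succeeds with probability at least `1/(2K²)`, and different `m` use
disjoint sets of lines, so a coordinatewise route is blocked with probability at most `ε = n
exp(-n/(4K²))` (`uniformProb_routeBlocked_le`).

Since there are exponentially many starting points `v`, this bound alone does not survive a union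
bound. But if `x` lists the winners at `v`, then `v` has an out-neighbour for each `j` with `x j ≠ v
j`. Routes from these, each keeping its own coordinate `j` at `x j`, use disjoint lines, so all fail
with probability about `ε` to a power proportional to their number (`uniformProb_fan_blocked_le`).
The winners at `v` equal `x` with probability `1/|A|`, which cancels the sum over `v`; the sum over
`x ≠ v` is a small generating function.

The routes aim at neighbours of `w`, all of which point to `w` once it is a sink. Replacing the
winners through `w` (`makeSink`) separates the event that `w` is a sink from the rest, and the sum
over `w` again cancels against `1/|A|`. -/

/-! ### Uniform probability and independence on finite products -/

section UniformProbability

theorem dependsOn_forall_mem {ι : Type*} {α : ι → Type*} {β : Type*} {s : Finset β} {E : β → (∀ i, α i) → Prop}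
    {S : Set ι} (h : ∀ b ∈ s, DependsOn (E b) S) :
    DependsOn (fun W => ∀ b ∈ s, E b W) S := by
  intro x y hxy
  exact propext (forall₂_congr fun b hb => iff_of_eq (h b hb hxy))

variable {ι : Type*} [Fintype ι] [DecidableEq ι] {α : ι → Type*}
  [∀ i, Fintype (α i)]

open Classical in
/-- The probability of the event `E` under the uniform distribution. -/
noncomputable def uniformProb {Ω : Type*} [Fintype Ω] (E : Ω → Prop) : ℝ :=
  ((Finset.univ.filter E).card : ℝ) / (Fintype.card Ω : ℝ)

section Basic

variable {Ω : Type*} [Fintype Ω]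

theorem uniformProb_eq (E : Ω → Prop) [DecidablePred E] :
    uniformProb E = ((Finset.univ.filter E).card : ℝ) / (Fintype.card Ω : ℝ) := by
  unfold uniformProb
  congr!

theorem uniformProb_nonneg (E : Ω → Prop) : 0 ≤ uniformProb E := by
  unfold uniformProb; positivity

theorem uniformProb_mono {E F : Ω → Prop} (h : ∀ W, E W → F W) :
    uniformProb E ≤ uniformProb F := by
  classical
  rw [uniformProb_eq, uniformProb_eq]
  gcongr
  exact h _

theorem uniformProb_congr {E F : Ω → Prop} (h : ∀ W, E W ↔ F W) :
    uniformProb E = uniformProb F := by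
  rw [show E = F from funext fun W => propext (h W)]

theorem uniformProb_true [Nonempty Ω] : uniformProb (fun _ : Ω => True) = 1 := by
  unfold uniformProb
  simp

theorem uniformProb_false : uniformProb (fun _ : Ω => False) = 0 := by
  unfold uniformProb
  simp

theorem uniformProb_or_le (E F : Ω → Prop) :
    uniformProb (fun W => E W ∨ F W) ≤ uniformProb E + uniformProb F := by
  classical
  rw [uniformProb_eq, uniformProb_eq, uniformProb_eq, ← add_div, Finset.filter_or]
  gcongr
  exact_mod_cast Finset.card_union_le _ _

theorem uniformProb_exists_le {β : Type*} (s : Finset β) (E : β → Ω → Prop) :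
    uniformProb (fun W => ∃ b ∈ s, E b W) ≤ ∑ b ∈ s, uniformProb (E b) := by
  classical
  induction s using Finset.induction_on with
  | empty => simp [uniformProb_false]
  | insert a s ha ih =>
    rw [Finset.sum_insert ha]
    calc _ = uniformProb (fun W => E a W ∨ ∃ b ∈ s, E b W) :=
          uniformProb_congr fun W => by simp
      _ ≤ _ := (uniformProb_or_le _ _).trans (by gcongr)

theorem uniformProb_not [Nonempty Ω] (E : Ω → Prop) :
    uniformProb (fun W => ¬ E W) = 1 - uniformProb E := by
  classical
  rw [uniformProb_eq, uniformProb_eq]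
  have h := Finset.card_filter_add_card_filter_not (s := (Finset.univ : Finset Ω)) E
  rw [Finset.card_univ] at h
  rw [eq_sub_iff_add_eq, ← add_div, div_eq_one_iff_eq (by positivity)]
  rw [add_comm]
  exact_mod_cast h

theorem uniformProb_exists_eq_sum {β : Type*} (s : Finset β) (E : β → Ω → Prop)
    (h : ∀ W, ∀ b ∈ s, ∀ c ∈ s, E b W → E c W → b = c) :
    uniformProb (fun W => ∃ b ∈ s, E b W) = ∑ b ∈ s, uniformProb (E b) := by
  classical
  simp only [uniformProb_eq]
  rw [← Finset.sum_div]
  congr 1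
  rw [← Nat.cast_sum, ← Finset.card_biUnion]
  · congr 2
    ext W
    simp
  · intro b hb c hc hbc
    rw [Function.onFun, Finset.disjoint_left]
    intro W h1 h2
    simp only [Finset.mem_filter, Finset.mem_univ, true_and] at h1 h2
    exact hbc (h W b hb c hc h1 h2)

end Basic

/-- Events that depend on disjoint sets of coordinates are independent. -/
theorem uniformProb_and_of_dependsOn [Nonempty (∀ i, α i)] {E F : (∀ i, α i) → Prop} {S T : Set ι}
    (hE : DependsOn E S) (hF : DependsOn F T) (hST : Disjoint S T) :
    uniformProb (fun W => E W ∧ F W) = uniformProb E * uniformProb F := by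
  classical
  -- Exchanging the coordinates outside `S` between the members of a pair is an involution. It
  -- carries the pairs with `E` for the first and `F` for the second to those whose first member
  -- satisfies both.
  have key : ((Finset.univ.filter E) ×ˢ (Finset.univ.filter F)).card =
      ((Finset.univ.filter fun W => E W ∧ F W) ×ˢ
        (Finset.univ : Finset (∀ i, α i))).card := by
    have e1 : ∀ x y : ∀ i, α i, E (S.piecewise x y) ↔ E x := fun x y =>
      iff_of_eq (hE fun i hi => by simp [hi])
    have e2 : ∀ x y : ∀ i, α i, F (S.piecewise x y) ↔ F y := fun x y =>
      iff_of_eq (hF fun i hi => by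
        have : i ∉ S := fun h => Set.disjoint_left.1 hST h hi
        simp [this])
    have inv : ∀ x y : ∀ i, α i,
        S.piecewise (S.piecewise x y) (S.piecewise y x) = x := by
      intro x y
      ext i
      by_cases hi : i ∈ S <;> simp [hi]
    refine Finset.card_nbij' (fun p => (S.piecewise p.1 p.2, S.piecewise p.2 p.1))
      (fun p => (S.piecewise p.1 p.2, S.piecewise p.2 p.1)) ?_ ?_ ?_ ?_
    · rintro ⟨x, y⟩ h
      simp only [Finset.coe_product, Set.mem_prod, Finset.coe_filter, Finset.mem_univ, true_and,
        Set.mem_ofPred_eq, Finset.coe_univ, Set.mem_univ, and_true] at h ⊢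
      exact ⟨(e1 _ _).2 h.1, (e2 _ _).2 h.2⟩
    · rintro ⟨x, y⟩ h
      simp only [Finset.coe_product, Set.mem_prod, Finset.coe_filter, Finset.mem_univ, true_and,
        Set.mem_ofPred_eq, Finset.coe_univ, Set.mem_univ, and_true] at h ⊢
      exact ⟨(e1 _ _).2 h.1, (e2 _ _).2 h.2⟩
    · rintro ⟨x, y⟩ _
      simp [inv]
    · rintro ⟨x, y⟩ _
      simp [inv]
  rw [Finset.card_product, Finset.card_product, Finset.card_univ] at key
  have hpos : (0 : ℝ) < (Fintype.card (∀ i, α i) : ℝ) := by exact_mod_cast Fintype.card_pos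
  rw [uniformProb_eq, uniformProb_eq, uniformProb_eq]
  rw [div_mul_div_comm, div_eq_div_iff hpos.ne' (by positivity)]
  have key' : ((Finset.univ.filter E).card : ℝ) * ((Finset.univ.filter F).card : ℝ) =
    ((Finset.univ.filter fun W => E W ∧ F W).card : ℝ) * (Fintype.card (∀ i, α i) : ℝ) := by
    exact_mod_cast key
  rw [key']
  ring1

/-- Mutual independence of events that depend on pairwise disjoint sets of coordinates. -/
theorem uniformProb_forall_of_dependsOn [Nonempty (∀ i, α i)] {β : Type*} (s : Finset β)
    (E : β → (∀ i, α i) → Prop) (S : β → Set ι) (hE : ∀ b ∈ s, DependsOn (E b) (S b))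
    (hS : ∀ b ∈ s, ∀ c ∈ s, b ≠ c → Disjoint (S b) (S c)) :
    uniformProb (fun W => ∀ b ∈ s, E b W) = ∏ b ∈ s, uniformProb (E b) := by
  classical
  induction s using Finset.induction_on with
  | empty => simp [uniformProb_true]
  | insert a s ha ih =>
    rw [Finset.prod_insert ha, ← ih (fun b hb => hE b (Finset.mem_insert_of_mem hb))
      (fun b hb c hc => hS b (Finset.mem_insert_of_mem hb) c (Finset.mem_insert_of_mem hc)),
      ← uniformProb_and_of_dependsOn (T := ⋃ b ∈ s, S b) (hE a (Finset.mem_insert_self _ _))]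
    · exact uniformProb_congr fun W => by simp
    · exact dependsOn_forall_mem fun b hb =>
        (hE b (Finset.mem_insert_of_mem hb)).mono (Set.subset_biUnion_of_mem (u := S) hb)
    · rw [Set.disjoint_iUnion₂_right]
      intro b hb
      exact hS a (Finset.mem_insert_self _ _) b (Finset.mem_insert_of_mem hb)
        (by rintro rfl; exact ha hb)

theorem uniformProb_eval_eq [Nonempty (∀ i, α i)] (i : ι) (a : α i) :
    uniformProb (fun W : ∀ i, α i => W i = a) = 1 / (Fintype.card (α i) : ℝ) := by
  classical
  have hN : ∀ j, Nonempty (α j) := fun j => ⟨Classical.arbitrary (∀ i, α i) j⟩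
  have hconst : ∀ b, uniformProb (fun W : ∀ i, α i => W i = b) =
      uniformProb (fun W : ∀ i, α i => W i = a) := by
    intro b
    rw [uniformProb_eq, uniformProb_eq]
    congr 2
    refine Finset.card_nbij' (fun W => Function.update W i (Equiv.swap a b (W i)))
      (fun W => Function.update W i (Equiv.swap a b (W i))) ?_ ?_ ?_ ?_
    · intro W hW; simp_all
    · intro W hW; simp_all
    · intro W _; simp
    · intro W _; simp
  have hsum := uniformProb_exists_eq_sum (Finset.univ : Finset (α i))
    (fun b (W : ∀ i, α i) => W i = b) (fun W b _ c _ h1 h2 => h1.symm.trans h2)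
  simp only [hconst, Finset.mem_univ, true_and, exists_eq', uniformProb_true, Finset.sum_const,
    Finset.card_univ, nsmul_eq_mul] at hsum
  rw [eq_div_iff (by positivity), mul_comm]
  exact hsum.symm

end UniformProbability

/-! ### Grid lines and their winners -/

section Lines

variable {n : ℕ} {k : Fin n → ℕ}

/-- The lines of the grid of action profiles: a direction together with the actions of all the
other players. -/
abbrev GridLine (n : ℕ) (k : Fin n → ℕ) : Type :=
  Σ i : Fin n, ((j : {j : Fin n // j ≠ i}) → Fin (k j))

/-- The line in direction `i` through the profile `a`. -/
def lineThrough (i : Fin n) (a : ActionProfile n k) : GridLine n k := ⟨i, fun j => a j⟩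

theorem lineThrough_eq_iff {i i' : Fin n} {a a' : ActionProfile n k} :
    lineThrough i a = lineThrough i' a' ↔ i = i' ∧ ∀ j, j ≠ i → a j = a' j := by
  unfold lineThrough
  constructor
  · intro h
    obtain ⟨h1, h2⟩ := Sigma.mk.inj h
    subst h1
    exact ⟨rfl, fun j hj => congrFun (eq_of_heq h2) ⟨j, hj⟩⟩
  · rintro ⟨rfl, h⟩
    congr 1
    ext j
    rw [h j j.2]

theorem lineThrough_update (i : Fin n) (a : ActionProfile n k) (x : Fin (k i)) :
    lineThrough i (Function.update a i x) = lineThrough i a :=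
  lineThrough_eq_iff.2 ⟨rfl, fun j hj => by simp [hj]⟩

/-- A choice of a winning action on every line: the data of a generic game that determine its
best-response graph. -/
abbrev LineWinners (n : ℕ) (k : Fin n → ℕ) : Type := (l : GridLine n k) → Fin (k l.1)

namespace LineWinners

/-- The winner of the line in direction `i` through `a`. -/
def winner (W : LineWinners n k) (i : Fin n) (a : ActionProfile n k) : Fin (k i) :=
  W (lineThrough i a)

theorem winner_update (W : LineWinners n k) (i : Fin n) (a : ActionProfile n k) (x : Fin (k i)) :
    W.winner i (Function.update a i x) = W.winner i a := by
  unfold winner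
  -- The two winners have types that depend on the line, hence the comparison of underlying numbers.
  have : ∀ l l' : GridLine n k, l = l' → (W l).val = (W l').val := by rintro l _ rfl; rfl
  exact Fin.ext (this _ _ (lineThrough_update i a x))

theorem winner_congr (W : LineWinners n k) {i : Fin n} {a b : ActionProfile n k}
    (h : ∀ j, j ≠ i → a j = b j) : W.winner i a = W.winner i b := by
  have : b = Function.update a i (b i) := by
    ext j
    by_cases hj : j = i
    · subst hj; simp
    · simp [hj, h j hj]
  rw [this, winner_update]

/-- Every profile points to the winners of the lines through it. -/
def Adj (W : LineWinners n k) (a b : ActionProfile n k) : Prop :=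
  ∃ i, W.winner i a ≠ a i ∧ b = Function.update a i (W.winner i a)

/-- Reachability along directed edges. -/
def Reach (W : LineWinners n k) : ActionProfile n k → ActionProfile n k → Prop :=
  Relation.ReflTransGen W.Adj

/-- A sink wins all the lines through it. -/
def IsSink (W : LineWinners n k) (a : ActionProfile n k) : Prop :=
  ∀ i, W.winner i a = a i

theorem adj_update {W : LineWinners n k} {i : Fin n} {a : ActionProfile n k} {x : Fin (k i)}
    (h : W.winner i a = x) (hx : x ≠ a i) : W.Adj a (Function.update a i x) :=
  ⟨i, by rwa [h], by rw [h]⟩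

theorem dependsOn_winner_eq (i : Fin n) (a : ActionProfile n k) (x : Fin (k i)) :
    DependsOn (fun W : LineWinners n k => W.winner i a = x) {lineThrough i a} := by
  intro W W' h
  have : winner W i a = winner W' i a := h _ rfl
  simp only [this]

theorem uniformProb_winner_eq (hk : ∀ i, 2 ≤ k i) (i : Fin n) (a : ActionProfile n k)
    (x : Fin (k i)) :
    uniformProb (fun W : LineWinners n k => W.winner i a = x) = 1 / (k i : ℝ) := by
  have : Nonempty (LineWinners n k) := ⟨fun l => ⟨0, by have := hk l.1; omega⟩⟩
  have h := uniformProb_eval_eq (α := fun l : GridLine n k => Fin (k l.1)) (lineThrough i a) x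
  exact h.trans (by rw [Fintype.card_fin]; rfl)

theorem nonempty (hk : ∀ i, 2 ≤ k i) : Nonempty (LineWinners n k) :=
  ⟨fun l => ⟨0, by have := hk l.1; omega⟩⟩

/-- The winners of the lines through a profile are independent and uniform. -/
theorem uniformProb_winners_eq (hk : ∀ i, 2 ≤ k i) (a x : ActionProfile n k) :
    uniformProb (fun W : LineWinners n k => ∀ i, W.winner i a = x i) = ∏ i, 1 / (k i : ℝ) := by
  have := nonempty hk
  have h := uniformProb_forall_of_dependsOn (Finset.univ : Finset (Fin n))
    (fun i (W : LineWinners n k) => W.winner i a = x i) (fun i => {lineThrough i a})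
    (fun i _ => dependsOn_winner_eq i a (x i))
    (fun i _ j _ hij => by
      rw [Set.disjoint_singleton]
      intro h
      exact hij (lineThrough_eq_iff.1 h).1)
  simp only [uniformProb_winner_eq hk, Finset.mem_univ, true_implies] at h
  exact h

theorem dependsOn_winners_eq (a x : ActionProfile n k) :
    DependsOn (fun W : LineWinners n k => ∀ i, W.winner i a = x i)
      {l | ∃ i, l = lineThrough i a} := by
  intro W W' h
  have : ∀ i, winner W i a = winner W' i a := fun i => h _ ⟨i, rfl⟩
  simp only [this]

end LineWinners

end Lines

/-! ### Changing one coordinate by a detour, and routes -/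

section Detours

variable {n : ℕ} {k : Fin n → ℕ}

namespace LineWinners

/-- From `c` one may deviate in coordinate `m`, then move coordinate `i` to `t`, and then undo
the deviation. -/
def Detour (W : LineWinners n k) (c : ActionProfile n k) (i : Fin n) (t : Fin (k i))
    (m : Fin n) : Prop :=
  ∃ x : Fin (k m), x ≠ c m ∧ W.winner m c = x ∧
    W.winner i (Function.update c m x) = t ∧ W.winner m (Function.update c i t) = c m

theorem Detour.reach {W : LineWinners n k} {c : ActionProfile n k} {i m : Fin n} {t : Fin (k i)}
    (h : W.Detour c i t m) (hm : m ≠ i) (ht : t ≠ c i) : W.Reach c (Function.update c i t) := by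
  obtain ⟨x, hx, h1, h2, h3⟩ := h
  refine .head (adj_update h1 hx) (.head (adj_update h2 (by simpa [hm.symm] using ht)) ?_)
  refine .single ?_
  rw [Function.update_comm hm]
  have h4 : W.winner m (Function.update (Function.update c i t) m x) = c m := by
    rw [winner_update, h3]
  have := adj_update h4 (by simpa using hx.symm)
  have e : Function.update (Function.update c i t) m (c m) = Function.update c i t := by
    rw [Function.update_comm hm.symm, Function.update_eq_self]
  rwa [Function.update_idem, e] at this

/-- The lines that a detour in direction `m` may use. -/
def detourLines (c : ActionProfile n k) (i : Fin n) (t : Fin (k i)) (m : Fin n) :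
    Set (GridLine n k) :=
  {l | l = lineThrough m c ∨ (∃ x : Fin (k m), x ≠ c m ∧ l = lineThrough i (Function.update c m x)) ∨
    l = lineThrough m (Function.update c i t)}

theorem dependsOn_detour (c : ActionProfile n k) (i : Fin n) (t : Fin (k i)) (m : Fin n) :
    DependsOn (fun W : LineWinners n k => W.Detour c i t m) (detourLines c i t m) := by
  intro W W' h
  have h1 : winner W m c = winner W' m c := h _ (.inl rfl)
  have h2 : ∀ x, x ≠ c m → winner W i (Function.update c m x) =
      winner W' i (Function.update c m x) := fun x hx => h _ (.inr (.inl ⟨x, hx, rfl⟩))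
  have h3 : winner W m (Function.update c i t) = winner W' m (Function.update c i t) :=
    h _ (.inr (.inr rfl))
  refine propext (exists_congr fun x => and_congr_right fun hx => ?_)
  simp only [h1, h2 x hx, h3]

/-- A line in direction `m` reveals `m`, and a line in direction `i` reveals it as the coordinate in
which it has left `c`. -/
theorem disjoint_detourLines {c : ActionProfile n k} {i m m' : Fin n} {t : Fin (k i)}
    (hm : m ≠ i) (hm' : m' ≠ i) (hmm : m ≠ m') :
    Disjoint (detourLines c i t m) (detourLines c i t m') := by
  rw [Set.disjoint_left]
  rintro l (rfl | ⟨x, hx, rfl⟩ | rfl) (h | ⟨y, hy, h⟩ | h) <;>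
    rw [lineThrough_eq_iff] at h <;> obtain ⟨h0, h⟩ := h
  · exact hmm h0
  · exact hm h0
  · exact hmm h0
  · exact hm' h0.symm
  · have := h m hm
    simp [hmm, hx] at this
  · exact hm' h0.symm
  · exact hmm h0
  · exact hm h0
  · exact hmm h0

/-- For each of the `k m - 1` deviations `x` three distinct lines must have a prescribed winner; the
two in direction `m` are distinct because they differ in coordinate `i`. -/
theorem uniformProb_detour (hk : ∀ i, 2 ≤ k i) {c : ActionProfile n k} {i m : Fin n}
    {t : Fin (k i)} (hm : m ≠ i) (ht : t ≠ c i) :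
    uniformProb (fun W : LineWinners n k => W.Detour c i t m) =
      ((k m : ℝ) - 1) * (1 / (k m : ℝ) * (1 / (k i : ℝ) * (1 / (k m : ℝ)))) := by
  classical
  have := nonempty hk
  have h0 : ∀ x : Fin (k m), x ≠ c m → uniformProb (fun W : LineWinners n k =>
      W.winner m c = x ∧
        W.winner i (Function.update c m x) = t ∧ W.winner m (Function.update c i t) = c m) =
        1 / (k m : ℝ) * (1 / (k i : ℝ) * (1 / (k m : ℝ))) := by
    intro x hx
    rw [uniformProb_and_of_dependsOn (dependsOn_winner_eq m c x) (T :=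
      {lineThrough i (Function.update c m x)} ∪ {lineThrough m (Function.update c i t)})
      (F := fun W : LineWinners n k =>
        W.winner i (Function.update c m x) = t ∧ W.winner m (Function.update c i t) = c m),
      uniformProb_and_of_dependsOn (dependsOn_winner_eq i _ t) (dependsOn_winner_eq m _ (c m)),
      uniformProb_winner_eq hk, uniformProb_winner_eq hk, uniformProb_winner_eq hk]
    · rw [Set.disjoint_singleton]
      intro h
      exact hm (lineThrough_eq_iff.1 h).1.symm
    · intro W W' h
      have h1 := dependsOn_winner_eq i (Function.update c m x) t
        (fun l hl => h l (.inl hl))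
      have h2 := dependsOn_winner_eq m (Function.update c i t) (c m)
        (fun l hl => h l (.inr hl))
      simp only at h1 h2 ⊢
      rw [h1, h2]
    · rw [Set.disjoint_singleton_left]
      rintro (h | h)
      · exact hm (lineThrough_eq_iff.1 h).1
      · have := (lineThrough_eq_iff.1 h).2 i hm.symm
        simp only [Function.update_self] at this
        exact ht this.symm
  have h1 := uniformProb_exists_eq_sum (Finset.univ.erase (c m))
    (fun (x : Fin (k m)) (W : LineWinners n k) => W.winner m c = x ∧
        W.winner i (Function.update c m x) = t ∧ W.winner m (Function.update c i t) = c m)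
    (fun W x _ y _ hx hy => hx.1.symm.trans hy.1)
  rw [Finset.sum_congr rfl (fun x hx => h0 x (Finset.ne_of_mem_erase hx)), Finset.sum_const,
    Finset.card_erase_of_mem (Finset.mem_univ _), Finset.card_univ, Fintype.card_fin,
    nsmul_eq_mul, Nat.cast_sub (by have := hk m; omega), Nat.cast_one] at h1
  rw [← h1]
  exact uniformProb_congr fun W => by simp [Detour]

theorem le_uniformProb_detour (hk : ∀ i, 2 ≤ k i) {K : ℝ} (hK : ∀ i, (k i : ℝ) ≤ K)
    {c : ActionProfile n k} {i m : Fin n}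
    {t : Fin (k i)} (hm : m ≠ i) (ht : t ≠ c i) :
    1 / (2 * K ^ 2) ≤ uniformProb (fun W : LineWinners n k => W.Detour c i t m) := by
  rw [uniformProb_detour hk hm ht]
  have h2m : (2 : ℝ) ≤ k m := by exact_mod_cast hk m
  have h2i : (2 : ℝ) ≤ k i := by exact_mod_cast hk i
  have e : ((k m : ℝ) - 1) * (1 / (k m : ℝ) * (1 / (k i : ℝ) * (1 / (k m : ℝ)))) =
    (((k m : ℝ) - 1) / k m) * (1 / (k i * k m)) := by field_simp
  rw [e, show 1 / (2 * K ^ 2) = (1 / 2) * (1 / (K * K)) by field_simp]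
  have hKi := hK i
  have hKm := hK m
  have hK0 : 0 < K := by linarith
  refine mul_le_mul ?_ ?_ (by positivity) (div_nonneg (by linarith) (by linarith))
  · rw [div_le_div_iff₀ (by norm_num) (by linarith)]
    linarith
  · refine one_div_le_one_div_of_le (mul_pos (by linarith) (by linarith)) ?_
    exact mul_le_mul hKi hKm (by linarith) (by linarith)

/-- No detour in the directions of `D` moves coordinate `i` of `c` to `t`. -/
def NoDetour (W : LineWinners n k) (D : Finset (Fin n)) (c : ActionProfile n k) (i : Fin n)
    (t : Fin (k i)) : Prop :=
  ∀ m ∈ D.erase i, ¬ W.Detour c i t m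

theorem uniformProb_noDetour_le (hk : ∀ i, 2 ≤ k i) {K : ℝ} (hK : ∀ i, (k i : ℝ) ≤ K)
    {c : ActionProfile n k} {i : Fin n} {t : Fin (k i)} (ht : t ≠ c i) {D : Finset (Fin n)}
    (hD : n ≤ 2 * (D.erase i).card) :
    uniformProb (fun W : LineWinners n k => W.NoDetour D c i t) ≤
      Real.exp (-(n / (4 * K ^ 2))) := by
  have := nonempty hk
  have hK2 : 2 ≤ K := le_trans (by exact_mod_cast hk i) (hK i)
  unfold NoDetour
  rw [uniformProb_forall_of_dependsOn (D.erase i)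
    (fun m (W : LineWinners n k) => ¬ W.Detour c i t m) (detourLines c i t)
    (fun m _ W W' h => by
      have := dependsOn_detour c i t m h
      simp only at this ⊢
      rw [this])
    (fun m hm m' hm' h => disjoint_detourLines (Finset.ne_of_mem_erase hm)
      (Finset.ne_of_mem_erase hm') h)]
  calc _ ≤ ∏ m ∈ D.erase i, Real.exp (-(1 / (2 * K ^ 2))) := by
        refine Finset.prod_le_prod (fun _ _ => uniformProb_nonneg _) fun m hm => ?_
        rw [uniformProb_not]
        have h1 := le_uniformProb_detour hk hK (Finset.ne_of_mem_erase hm) ht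
        have h2 := Real.add_one_le_exp (-(1 / (2 * K ^ 2)))
        linarith
    _ ≤ _ := by
        -- At least `n/2` directions, each contributing `1/(2K²)` to the exponent.
        rw [Finset.prod_const, ← Real.exp_nat_mul, Real.exp_le_exp]
        have : (n : ℝ) ≤ 2 * ((D.erase i).card : ℝ) := by exact_mod_cast hD
        rw [mul_neg, neg_le_neg_iff, mul_one_div, div_le_div_iff₀ (by positivity) (by positivity)]
        nlinarith [sq_nonneg K]

/-- The profile that agrees with `b` before coordinate `t` and with `a` from there on. -/
def splice (a b : ActionProfile n k) (t : ℕ) : ActionProfile n k :=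
  fun i => if (i : ℕ) < t then b i else a i

theorem splice_zero (a b : ActionProfile n k) : splice a b 0 = a := by
  ext j
  simp [splice]

theorem splice_self (a b : ActionProfile n k) : splice a b n = b := by
  ext j
  simp [splice]

theorem splice_succ (a b : ActionProfile n k) (i : Fin n) :
    splice a b (i + 1) = Function.update (splice a b i) i (b i) := by
  ext j
  by_cases hj : j = i
  · subst hj; simp [splice]
  · have : (j : ℕ) ≠ i := fun h => hj (Fin.ext h)
    have : (j : ℕ) < i + 1 ↔ (j : ℕ) < i := by omega
    simp [splice, hj, this]

/-- The route from `a` to `b` that moves the coordinates one after the other, with detours in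
directions from `D`, is blocked. -/
def RouteBlocked (W : LineWinners n k) (D : Finset (Fin n)) (a b : ActionProfile n k) : Prop :=
  ∃ i ∈ Finset.univ.filter (fun i => b i ≠ a i), W.NoDetour D (splice a b i) i (b i)

theorem reach_of_not_routeBlocked {W : LineWinners n k} {D : Finset (Fin n)}
    {a b : ActionProfile n k} (h : ¬ W.RouteBlocked D a b) : W.Reach a b := by
  have key : ∀ t : ℕ, t ≤ n → W.Reach a (splice a b t) := by
    intro t
    induction t with
    | zero => intro _; rw [splice_zero]; exact .refl
    | succ t ih =>
      intro ht
      refine (ih (by omega)).trans ?_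
      have e := splice_succ a b ⟨t, ht⟩
      simp only at e
      rw [e]
      have hs : splice a b t ⟨t, ht⟩ = a ⟨t, ht⟩ := by simp [splice]
      by_cases hab : b ⟨t, ht⟩ = a ⟨t, ht⟩
      · rw [hab, ← hs, Function.update_eq_self]
      · simp only [RouteBlocked, NoDetour, Finset.mem_filter, Finset.mem_univ, true_and] at h
        push Not at h
        obtain ⟨m, hm, hd⟩ := h _ hab
        exact hd.reach (Finset.ne_of_mem_erase hm) (by rwa [hs])
  simpa only [splice_self] using key n le_rfl

theorem uniformProb_routeBlocked_le (hk : ∀ i, 2 ≤ k i) {K : ℝ} (hK : ∀ i, (k i : ℝ) ≤ K)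
    (a b : ActionProfile n k) {D : Finset (Fin n)} (hD : ∀ i, n ≤ 2 * (D.erase i).card) :
    uniformProb (fun W : LineWinners n k => W.RouteBlocked D a b) ≤
      n * Real.exp (-(n / (4 * K ^ 2))) := by
  unfold RouteBlocked
  refine (uniformProb_exists_le _ _).trans ?_
  calc _ ≤ ∑ i ∈ Finset.univ.filter (fun i => b i ≠ a i), Real.exp (-(n / (4 * K ^ 2))) := by
        refine Finset.sum_le_sum fun i hi => uniformProb_noDetour_le hk hK ?_ (hD i)
        simpa [splice] using hi
    _ ≤ _ := by
        rw [Finset.sum_const, nsmul_eq_mul]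
        gcongr
        exact (Finset.card_le_univ _).trans (by simp)

end LineWinners

end Detours

/-! ### Many independent routes from a non-sink -/

section Fans

variable {n : ℕ} {k : Fin n → ℕ}

namespace LineWinners

/-- Lines meeting, in a direction other than `j`, the set of profiles whose only coordinate in `J`
that agrees with `x` is `j`. -/
def tagLines (x : ActionProfile n k) (J : Finset (Fin n)) (j : Fin n) : Set (GridLine n k) :=
  {l | ∃ (c : ActionProfile n k) (i : Fin n), l = lineThrough i c ∧ i ≠ j ∧ c j = x j ∧
    ∀ l ∈ J, l ≠ j → c l ≠ x l}

/-- A line tagged `j` does not run in direction `j`, so all its points agree with `x` at `j`, which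
the tag `j'` forbids. -/
theorem disjoint_tagLines {x : ActionProfile n k} {J : Finset (Fin n)} {j j' : Fin n}
    (hj : j ∈ J) (hjj : j ≠ j') : Disjoint (tagLines x J j) (tagLines x J j') := by
  rw [Set.disjoint_left]
  rintro l ⟨c, i, rfl, hij, hc, -⟩ ⟨c', i', hl, hij', -, hc'⟩
  obtain ⟨rfl, h⟩ := lineThrough_eq_iff.1 hl
  exact hc' j hj hjj ((h j hij.symm).symm.trans hc)

/-- Both endpoints have `x j` at `j`, so the route never moves `j`. Detours avoid `J`, so the other
coordinates in `J` take only values of `v` and `h`, never that of `x`. -/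
theorem dependsOn_routeBlocked {v h x : ActionProfile n k} {J : Finset (Fin n)}
    (hv : ∀ j ∈ J, x j ≠ v j) (hh : ∀ j ∈ J, x j ≠ h j) {j : Fin n} (hj : j ∈ J) :
    DependsOn (fun W : LineWinners n k => W.RouteBlocked Jᶜ (Function.update v j (x j))
      (Function.update h j (x j))) (tagLines x J j) := by
  intro W W' hW
  refine propext (exists_congr fun i => and_congr_right fun hi => ?_)
  refine forall₂_congr fun m hm => not_congr (iff_of_eq (dependsOn_detour _ _ _ _ ?_))
  have hmi := Finset.ne_of_mem_erase hm
  have hmJ : m ∉ J := Finset.mem_compl.1 (Finset.mem_of_mem_erase hm)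
  have hmj : m ≠ j := fun e => hmJ (e ▸ hj)
  have hij : i ≠ j := by
    rintro rfl
    simp at hi
  set c := splice (Function.update v j (x j)) (Function.update h j (x j)) i with hc
  have hcj : c j = x j := by simp [hc, splice]
  have hcl : ∀ l ∈ J, l ≠ j → c l ≠ x l := by
    intro l hl hlj
    simp only [hc, splice, Function.update_of_ne hlj]
    split_ifs
    · exact (hh l hl).symm
    · exact (hv l hl).symm
  rintro l (rfl | ⟨y, hy, rfl⟩ | rfl)
  · exact hW _ ⟨c, m, rfl, hmj, hcj, hcl⟩
  · refine hW _ ⟨_, i, rfl, hij, ?_, fun l hl hlj => ?_⟩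
    · rw [Function.update_of_ne hmj.symm, hcj]
    · rw [Function.update_of_ne (by rintro rfl; exact hmJ hl)]
      exact hcl l hl hlj
  · refine hW _ ⟨_, m, rfl, hmj, ?_, fun l hl hlj => ?_⟩
    · rw [Function.update_of_ne hij.symm, hcj]
    · by_cases hli : l = i
      · subst hli
        rw [Function.update_self, Function.update_of_ne hlj]
        exact (hh l hl).symm
      · rw [Function.update_of_ne hli]
        exact hcl l hl hlj

/-- The routes are independent by their tags, and also independent of the winners at `v`: since `v`
differs from `x` on `J`, no line through `v` carries a tag. -/
theorem uniformProb_fan_blocked_le (hk : ∀ i, 2 ≤ k i) {K : ℝ} (hK : ∀ i, (k i : ℝ) ≤ K)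
    {v h x : ActionProfile n k} {J : Finset (Fin n)} (hv : ∀ j ∈ J, x j ≠ v j)
    (hh : ∀ j ∈ J, x j ≠ h j) (hJ : ∀ i, n ≤ 2 * (Jᶜ.erase i).card) :
    uniformProb (fun W : LineWinners n k => (∀ i, W.winner i v = x i) ∧
      ∀ j ∈ J, W.RouteBlocked Jᶜ (Function.update v j (x j)) (Function.update h j (x j))) ≤
      (∏ i, 1 / (k i : ℝ)) * (n * Real.exp (-(n / (4 * K ^ 2)))) ^ J.card := by
  have := nonempty hk
  have hdep : ∀ j ∈ J, DependsOn (fun W : LineWinners n k => W.RouteBlocked Jᶜ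
      (Function.update v j (x j)) (Function.update h j (x j))) (tagLines x J j) :=
    fun j hj => dependsOn_routeBlocked hv hh hj
  rw [uniformProb_and_of_dependsOn (dependsOn_winners_eq v x) (T := ⋃ j ∈ J, tagLines x J j)
    (F := fun W : LineWinners n k => ∀ j ∈ J, W.RouteBlocked Jᶜ (Function.update v j (x j))
      (Function.update h j (x j))), uniformProb_winners_eq hk,
    uniformProb_forall_of_dependsOn J _ _ hdep
      (fun j hj j' _ hjj => disjoint_tagLines hj hjj)]
  · gcongr
    · rw [← Finset.prod_const]
      exact Finset.prod_le_prod (fun _ _ => uniformProb_nonneg _)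
        fun j _ => uniformProb_routeBlocked_le hk hK _ _ hJ
  · exact dependsOn_forall_mem fun j hj =>
      (hdep j hj).mono (Set.subset_biUnion_of_mem (u := tagLines x J) hj)
  · rw [Set.disjoint_iUnion₂_right]
    intro j hj
    rw [Set.disjoint_left]
    rintro l ⟨i, rfl⟩ ⟨c, i', hl, hij, hc, -⟩
    obtain ⟨rfl, e⟩ := lineThrough_eq_iff.1 hl
    exact hv j hj ((e j hij.symm).trans hc).symm

/-- Of two profiles that differ everywhere, one differs from `x` in many of the coordinates in
which `x` differs from `v`. -/
theorem exists_tags (hn : 4 ≤ n) {w w' : ActionProfile n k} (hw : ∀ i, w' i ≠ w i)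
    (v x : ActionProfile n k) :
    ∃ h, (h = w ∨ h = w') ∧ ∃ J : Finset (Fin n), (∀ j ∈ J, x j ≠ v j) ∧ (∀ j ∈ J, x j ≠ h j) ∧
      (∀ i, n ≤ 2 * (Jᶜ.erase i).card) ∧
      (Finset.univ.filter fun i => x i ≠ v i).card ≤ 8 * J.card := by
  set I := Finset.univ.filter fun i => x i ≠ v i with hI
  have hIn : I.card ≤ n := (Finset.card_le_univ _).trans (by simp)
  have hsum : I.card ≤ (I.filter fun i => x i ≠ w i).card + (I.filter fun i => x i ≠ w' i).card := by
    refine le_trans (Finset.card_le_card ?_) (Finset.card_union_le _ _)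
    intro i hi
    simp only [Finset.mem_union, Finset.mem_filter, hi, true_and]
    by_contra! hc
    exact hw i (hc.2.symm.trans hc.1)
  have main : ∀ h : ActionProfile n k, I.card ≤ 2 * (I.filter fun i => x i ≠ h i).card →
      ∃ J : Finset (Fin n), (∀ j ∈ J, x j ≠ v j) ∧ (∀ j ∈ J, x j ≠ h j) ∧
        (∀ i, n ≤ 2 * (Jᶜ.erase i).card) ∧ I.card ≤ 8 * J.card := by
    intro h hh
    -- Cutting `J` down to at most `n / 4` elements leaves half of the directions for detours; as `n
    -- ≤ 8 * (n / 4)` for `4 ≤ n`, the factor 8 absorbs the loss.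
    obtain ⟨J, hJ, hcard⟩ := Finset.exists_subset_card_eq
      (min_le_left (I.filter fun i => x i ≠ h i).card (n / 4))
    refine ⟨J, fun j hj => ?_, fun j hj => ?_, fun i => ?_, by omega⟩
    · exact (Finset.mem_filter.1 (Finset.mem_filter.1 (hJ hj)).1).2
    · exact (Finset.mem_filter.1 (hJ hj)).2
    · have h1 := Finset.card_compl_add_card J
      have h2 := Finset.pred_card_le_card_erase (s := Jᶜ) (a := i)
      rw [Fintype.card_fin] at h1
      omega
  rcases le_total (I.filter fun i => x i ≠ w i).card (I.filter fun i => x i ≠ w' i).card with hl | hl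
  · exact ⟨w', .inr rfl, main w' (by omega)⟩
  · exact ⟨w, .inl rfl, main w (by omega)⟩

/-- The sum factorises over coordinates into terms `1 + (k i - 1) r ≤ exp (K r)`. -/
theorem sum_pow_hammingDist_le {K r : ℝ} (hK : ∀ i, (k i : ℝ) ≤ K) (hr : 0 ≤ r)
    (v : ActionProfile n k) :
    ∑ x : ActionProfile n k, r ^ (Finset.univ.filter fun i => x i ≠ v i).card ≤
      Real.exp (n * K * r) := by
  have e : ∀ x : ActionProfile n k, r ^ (Finset.univ.filter fun i => x i ≠ v i).card =
      ∏ i, if x i ≠ v i then r else 1 := by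
    intro x
    rw [Finset.prod_ite]
    simp
  simp_rw [e]
  have h := Finset.prod_univ_sum (fun i => (Finset.univ : Finset (Fin (k i))))
    (fun i y => if y ≠ v i then r else 1)
  rw [Fintype.piFinset_univ] at h
  rw [← h]
  calc _ ≤ ∏ i : Fin n, Real.exp (K * r) := by
        refine Finset.prod_le_prod (fun i _ => Finset.sum_nonneg fun y _ => by split_ifs <;> simp [hr])
          fun i _ => ?_
        rw [← Finset.add_sum_erase _ _ (Finset.mem_univ (v i))]
        rw [Finset.sum_congr rfl (fun y hy => if_pos (Finset.ne_of_mem_erase hy)), if_neg (by simp),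
          Finset.sum_const, nsmul_eq_mul]
        have h1 : ((Finset.univ.erase (v i)).card : ℝ) ≤ K :=
          le_trans (by exact_mod_cast (Finset.card_le_univ _).trans (by simp)) (hK i)
        have h2 := Real.add_one_le_exp (K * r)
        nlinarith
    _ = _ := by
        rw [Finset.prod_const, ← Real.exp_nat_mul, Finset.card_univ, Fintype.card_fin, mul_assoc]

/-- `W` has a non-sink from which no neighbour of `w` can be reached. -/
def HasStrandedVertex (W : LineWinners n k) (w : ActionProfile n k) : Prop :=
  ∃ v, ¬ W.IsSink v ∧ ∀ i y, y ≠ w i → ¬ W.Reach v (Function.update w i y)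

/-- Union bound over the profile `x` of winners at `v`. The case `x = v` is that of a sink; its
omission gives the `- 1`. Two targets are needed because `x` may agree with `w` almost everywhere,
leaving too few tags. -/
theorem uniformProb_stranded_le (hk : ∀ i, 2 ≤ k i) {K r : ℝ} (hK : ∀ i, (k i : ℝ) ≤ K)
    (hn : 4 ≤ n) (hr : 0 ≤ r) (hr1 : r ≤ 1) (hε : n * Real.exp (-(n / (4 * K ^ 2))) ≤ r ^ 8)
    {w w' : ActionProfile n k} (hw : ∀ i, w' i ≠ w i) (v : ActionProfile n k) :
    uniformProb (fun W : LineWinners n k => ¬ W.IsSink v ∧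
      ∀ h, (h = w ∨ h = w') → ∀ i y, y ≠ h i → ¬ W.Reach v (Function.update h i y)) ≤
      (∏ i, 1 / (k i : ℝ)) * (Real.exp (n * K * r) - 1) := by
  classical
  choose h hhw J hJv hJh hJ hcard using fun x => exists_tags hn hw v x
  calc _ ≤ uniformProb (fun W : LineWinners n k => ∃ x ∈ Finset.univ.erase v,
        (∀ i, W.winner i v = x i) ∧ ∀ j ∈ J x, W.RouteBlocked (J x)ᶜ (Function.update v j (x j))
          (Function.update (h x) j (x j))) := by
        refine uniformProb_mono fun W hW => ?_
        obtain ⟨h1, h2⟩ := hW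
        refine ⟨fun i => W.winner i v, ?_, fun i => rfl, fun j hj => ?_⟩
        · rw [Finset.mem_erase]
          refine ⟨fun e => h1 fun i => congrFun e i, Finset.mem_univ _⟩
        · by_contra hb
          refine h2 _ (hhw _) j _ (hJh _ j hj) (.head (adj_update rfl (hJv _ j hj)) ?_)
          exact reach_of_not_routeBlocked hb
    _ ≤ ∑ x ∈ Finset.univ.erase v, (∏ i, 1 / (k i : ℝ)) *
          r ^ (Finset.univ.filter fun i => x i ≠ v i).card := by
        refine (uniformProb_exists_le _ _).trans (Finset.sum_le_sum fun x _ => ?_)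
        refine (uniformProb_fan_blocked_le hk hK (hJv x) (hJh x) (hJ x)).trans ?_
        gcongr
        · calc _ ≤ (r ^ 8) ^ (J x).card := by gcongr
            _ = r ^ (8 * (J x).card) := (pow_mul _ _ _).symm
            _ ≤ _ := pow_le_pow_of_le_one hr hr1 (hcard x)
    _ ≤ _ := by
        rw [← Finset.mul_sum]
        gcongr
        · have h1 := sum_pow_hammingDist_le hK hr v
          rw [← Finset.add_sum_erase _ _ (Finset.mem_univ v)] at h1
          simp only [ne_eq, not_true_eq_false, Finset.filter_false, Finset.card_empty,
            pow_zero] at h1 ⊢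
          linarith

/-- The expected number of sinks is one; this cancels the union bounds over profiles. -/
theorem card_actionProfile_mul (hk : ∀ i, 2 ≤ k i) :
    (Fintype.card (ActionProfile n k) : ℝ) * ∏ i, 1 / (k i : ℝ) = 1 := by
  rw [Fintype.card_pi]
  push_cast
  rw [← Finset.prod_mul_distrib]
  refine Finset.prod_eq_one fun i _ => ?_
  have : (k i : ℝ) ≠ 0 := by have := hk i; positivity
  rw [Fintype.card_fin]
  field_simp

/-- A fan that ends at a neighbour of the auxiliary profile `w'` is continued by a route to one
fixed neighbour `b` of `w`; there are at most `n K` such routes. -/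
theorem uniformProb_hasStrandedVertex_le (hk : ∀ i, 2 ≤ k i) {K r : ℝ} (hK : ∀ i, (k i : ℝ) ≤ K)
    (hn : 4 ≤ n) (hr : 0 ≤ r) (hr1 : r ≤ 1) (hε : n * Real.exp (-(n / (4 * K ^ 2))) ≤ r ^ 8)
    (w : ActionProfile n k) :
    uniformProb (fun W : LineWinners n k => W.HasStrandedVertex w) ≤
      (Real.exp (n * K * r) - 1) + n * K * r ^ 8 := by
  classical
  have hex : ∀ i, ∃ y, y ≠ w i := fun i => by
    have : Nontrivial (Fin (k i)) := Fin.nontrivial_iff_two_le.2 (hk i)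
    exact exists_ne _
  choose w' hw using hex
  let i₀ : Fin n := ⟨0, by omega⟩
  let b := Function.update w i₀ (w' i₀)
  calc _ ≤ uniformProb (fun W : LineWinners n k =>
        (∃ v ∈ (Finset.univ : Finset (ActionProfile n k)), ¬ W.IsSink v ∧
          ∀ h, (h = w ∨ h = w') → ∀ i y, y ≠ h i → ¬ W.Reach v (Function.update h i y)) ∨
        ∃ p ∈ (Finset.univ : Finset (Σ i, Fin (k i))),
          W.RouteBlocked Finset.univ (Function.update w' p.1 p.2) b) := by
        refine uniformProb_mono fun W ⟨v, hv, hv'⟩ => ?_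
        by_contra! hc
        obtain ⟨h1, h2⟩ := hc
        obtain ⟨h, rfl | rfl, i, y, hy, hr⟩ := h1 v (Finset.mem_univ _) hv
        · exact hv' i y hy hr
        · exact hv' i₀ (h i₀) (hw i₀)
            (hr.trans (reach_of_not_routeBlocked (h2 ⟨i, y⟩ (Finset.mem_univ _))))
    _ ≤ _ := by
        refine (uniformProb_or_le _ _).trans (add_le_add ?_ ?_)
        · refine (uniformProb_exists_le _ _).trans ?_
          refine (Finset.sum_le_sum fun v _ =>
            uniformProb_stranded_le hk hK hn hr hr1 hε hw v).trans ?_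
          rw [Finset.sum_const, nsmul_eq_mul, Finset.card_univ, ← mul_assoc,
            card_actionProfile_mul hk, one_mul]
        · refine (uniformProb_exists_le _ _).trans ?_
          refine (Finset.sum_le_sum fun p _ => (uniformProb_routeBlocked_le hk hK _ _ ?_).trans
            hε).trans ?_
          · intro i
            rw [Finset.card_erase_of_mem (Finset.mem_univ _), Finset.card_univ, Fintype.card_fin]
            omega
          · rw [Finset.sum_const, nsmul_eq_mul, Finset.card_univ, Fintype.card_sigma]
            gcongr
            push_cast
            refine (Finset.sum_le_card_nsmul _ _ K fun i _ => ?_).trans ?_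
            · rw [Fintype.card_fin]
              exact hK i
            · simp

end LineWinners

end Fans

/-! ### Planting a sink, and existence of sinks -/

section Sinks

variable {n : ℕ} {k : Fin n → ℕ}

namespace LineWinners

open Classical in
/-- Let `w` win all the lines through it. -/
noncomputable def makeSink (w : ActionProfile n k) (W : LineWinners n k) : LineWinners n k :=
  fun l => if ∃ i, l = lineThrough i w then w l.1 else W l

theorem isSink_makeSink (w : ActionProfile n k) (W : LineWinners n k) :
    (makeSink w W).IsSink w := by
  intro i
  exact if_pos ⟨i, rfl⟩

theorem makeSink_eq_self {w : ActionProfile n k} {W : LineWinners n k} (h : W.IsSink w) :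
    makeSink w W = W := by
  ext l
  unfold makeSink
  split_ifs with hl
  · obtain ⟨i, rfl⟩ := hl
    rw [← h]
    rfl
  · rfl

theorem winner_makeSink {w a : ActionProfile n k} (W : LineWinners n k) {i : Fin n}
    (h : ¬ ∀ j, j ≠ i → a j = w j) : (makeSink w W).winner i a = W.winner i a := by
  refine if_neg ?_
  rintro ⟨i', hi⟩
  exact h (lineThrough_eq_iff.1 hi).2

theorem makeSink_adj {w a : ActionProfile n k} (W : LineWinners n k) {i : Fin n}
    (h : ∀ j, j ≠ i → a j = w j) (ha : a i ≠ w i) : (makeSink w W).Adj a w := by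
  have h1 : (makeSink w W).winner i a = w i := by
    rw [winner_congr _ h, isSink_makeSink]
  have e : Function.update a i (w i) = w := by
    ext j
    by_cases hj : j = i
    · subst hj; simp
    · simp [hj, h j hj]
  have h2 := adj_update h1 ha.symm
  rwa [e] at h2

/-- A path keeps its edges until it first meets a line through `w`; from there the modified winners
lead to `w` in at most one step. -/
theorem makeSink_reach {w v : ActionProfile n k} {W : LineWinners n k} {i : Fin n}
    {y : Fin (k i)} (hy : y ≠ w i) (h : W.Reach v (Function.update w i y)) :
    (makeSink w W).Reach v w := by
  induction h using Relation.ReflTransGen.head_induction_on with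
  | refl => exact .single (makeSink_adj W (i := i) (fun j hj => by simp [hj]) (by simpa using hy))
  | @head a c hac _ ih =>
    by_cases hw : ∃ i, ∀ j, j ≠ i → a j = w j
    · obtain ⟨i', hi'⟩ := hw
      by_cases ha : a i' = w i'
      · have : a = w := by
          ext j
          by_cases hj : j = i'
          · subst hj; rw [ha]
          · rw [hi' j hj]
        rw [this]
        exact .refl
      · exact .single (makeSink_adj W hi' ha)
    · refine .head ?_ ih
      obtain ⟨i', h1, rfl⟩ := hac
      have e := winner_makeSink W (fun h => hw ⟨i', h⟩)
      rw [← e]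
      exact ⟨i', by rwa [e], rfl⟩

/-- Some non-sink cannot reach `w`. -/
def Misses (W : LineWinners n k) (w : ActionProfile n k) : Prop :=
  ∃ v, ¬ W.IsSink v ∧ ¬ W.Reach v w

theorem Misses.hasStrandedVertex {w : ActionProfile n k} {W : LineWinners n k}
    (h : (makeSink w W).Misses w) : W.HasStrandedVertex w := by
  obtain ⟨v, hv, hr⟩ := h
  refine ⟨v, fun hs => ?_, fun i y hy hvy => hr (makeSink_reach hy hvy)⟩
  by_cases hw : ∃ i, ∀ j, j ≠ i → v j = w j
  · obtain ⟨i, hi⟩ := hw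
    by_cases ha : v i = w i
    · have : v = w := by
        ext j
        by_cases hj : j = i
        · subst hj; rw [ha]
        · rw [hi j hj]
      exact hv (this ▸ isSink_makeSink w W)
    · exact hr (.single (makeSink_adj W hi ha))
  · exact hv fun i => (winner_makeSink W (fun h => hw ⟨i, h⟩)).trans (hs i)

theorem uniformProb_isSink (hk : ∀ i, 2 ≤ k i) (a : ActionProfile n k) :
    uniformProb (fun W : LineWinners n k => W.IsSink a) = ∏ i, 1 / (k i : ℝ) :=
  uniformProb_winners_eq hk a a

theorem uniformProb_exists_isSink_and_misses_le (hk : ∀ i, 2 ≤ k i) {β : ℝ}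
    (hβ : ∀ w, uniformProb (fun W : LineWinners n k => W.HasStrandedVertex w) ≤ β) :
    uniformProb (fun W : LineWinners n k => ∃ w, W.IsSink w ∧ W.Misses w) ≤ β := by
  have := nonempty hk
  calc _ = uniformProb (fun W : LineWinners n k =>
        ∃ w ∈ (Finset.univ : Finset (ActionProfile n k)), W.IsSink w ∧ W.Misses w) :=
        uniformProb_congr fun W => by simp
    _ ≤ ∑ w : ActionProfile n k, (∏ i, 1 / (k i : ℝ)) * β := by
        refine (uniformProb_exists_le _ _).trans (Finset.sum_le_sum fun w _ => ?_)
        -- On the event that `w` is a sink, `makeSink` changes nothing; but `makeSink w W` ignores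
        -- the lines through `w`, so the second event becomes independent of the first.
        have e : uniformProb (fun W : LineWinners n k => W.IsSink w ∧ W.Misses w) =
            uniformProb (fun W : LineWinners n k => W.IsSink w ∧ (makeSink w W).Misses w) :=
          uniformProb_congr fun W => and_congr_right fun h => by rw [makeSink_eq_self h]
        rw [e, uniformProb_and_of_dependsOn (E := fun W : LineWinners n k => W.IsSink w)
          (dependsOn_winners_eq w w)
          (F := fun W : LineWinners n k => (makeSink w W).Misses w)
          (T := {l | ∃ i, l = lineThrough i w}ᶜ) ?_ disjoint_compl_right,
          uniformProb_isSink hk]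
        · gcongr
          exact (uniformProb_mono fun W h => h.hasStrandedVertex).trans (hβ w)
        · intro W W' h
          have : makeSink w W = makeSink w W' := by
            ext l
            unfold makeSink
            split_ifs with hl
            · rfl
            · rw [h l hl]
          simp only [this]
    _ = β := by
        rw [Finset.sum_const, nsmul_eq_mul, Finset.card_univ, ← mul_assoc,
          card_actionProfile_mul hk, one_mul]

/-- Two distinct profiles on a common line cannot both win it; otherwise they share no line and the
events are independent. -/
theorem uniformProb_isSink_and_isSink_le (hk : ∀ i, 2 ≤ k i) {a b : ActionProfile n k}
    (hab : a ≠ b) :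
    uniformProb (fun W : LineWinners n k => W.IsSink a ∧ W.IsSink b) ≤
      (∏ i, 1 / (k i : ℝ)) * ∏ i, 1 / (k i : ℝ) := by
  have := nonempty hk
  by_cases h : ∃ i, ∀ j, j ≠ i → a j = b j
  · obtain ⟨i, hi⟩ := h
    have e : uniformProb (fun W : LineWinners n k => W.IsSink a ∧ W.IsSink b) = 0 := by
      rw [← uniformProb_false (Ω := LineWinners n k)]
      refine uniformProb_congr fun W => iff_false_intro fun ⟨ha, hb⟩ => hab ?_
      ext j
      by_cases hj : j = i
      · subst hj
        rw [← ha, ← hb, winner_congr W hi]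
      · rw [hi j hj]
    rw [e]
    positivity
  · refine le_of_eq ?_
    have := uniformProb_and_of_dependsOn (dependsOn_winners_eq a a) (dependsOn_winners_eq b b) ?_
    · rwa [uniformProb_winners_eq hk, uniformProb_winners_eq hk] at this
    · rw [Set.disjoint_left]
      rintro l ⟨i, rfl⟩ ⟨i', hl⟩
      exact h ⟨i, (lineThrough_eq_iff.1 hl).2⟩

/-- Second moment bound for the existence of a sink. -/
theorem half_le_uniformProb_exists_isSink (hk : ∀ i, 2 ≤ k i) :
    1 / 2 ≤ uniformProb (fun W : LineWinners n k => ∃ a, W.IsSink a) := by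
  classical
  have := nonempty hk
  have hpos : (0 : ℝ) < Fintype.card (LineWinners n k) := by exact_mod_cast Fintype.card_pos
  set q : ℝ := ∏ i, 1 / (k i : ℝ) with hq
  have hq0 : 0 ≤ q := Finset.prod_nonneg fun i _ => by positivity
  have hAq := card_actionProfile_mul hk
  rw [← hq] at hAq
  have hind : ∀ (E : LineWinners n k → Prop) [DecidablePred E],
      ∑ W, (if E W then (1 : ℝ) else 0) = uniformProb E * Fintype.card (LineWinners n k) := by
    intro E _
    rw [uniformProb_eq, div_mul_cancel₀ _ hpos.ne']
    simp
  let S : LineWinners n k → ℝ := fun W => ∑ a, if W.IsSink a then 1 else 0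
  have h1 : ∑ W, S W = Fintype.card (LineWinners n k) := by
    rw [Finset.sum_comm]
    simp_rw [hind, uniformProb_isSink hk]
    rw [Finset.sum_const, nsmul_eq_mul, Finset.card_univ, ← mul_assoc, hAq, one_mul]
  have h2 : ∑ W, S W ^ 2 ≤ 2 * Fintype.card (LineWinners n k) := by
    have e : ∀ W, S W ^ 2 = ∑ a, ∑ b, if W.IsSink a ∧ W.IsSink b then 1 else 0 := by
      intro W
      rw [sq, Finset.sum_mul_sum]
      refine Finset.sum_congr rfl fun a _ => Finset.sum_congr rfl fun b _ => ?_
      by_cases ha : W.IsSink a <;> by_cases hb : W.IsSink b <;> simp [ha, hb]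
    simp_rw [e]
    rw [Finset.sum_comm]
    have h3 : ∀ a : ActionProfile n k, ∑ W : LineWinners n k, ∑ b,
        (if W.IsSink a ∧ W.IsSink b then (1 : ℝ) else 0) ≤
          (q + q) * Fintype.card (LineWinners n k) := by
      intro a
      rw [Finset.sum_comm]
      simp_rw [hind]
      rw [← Finset.sum_mul, ← Finset.add_sum_erase _ _ (Finset.mem_univ a)]
      gcongr
      · exact (uniformProb_congr fun W => and_self_iff).le.trans (uniformProb_isSink hk a).le
      · calc _ ≤ ∑ b ∈ Finset.univ.erase a, q * q := Finset.sum_le_sum fun b hb =>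
              uniformProb_isSink_and_isSink_le hk (Finset.ne_of_mem_erase hb).symm
          _ ≤ ∑ b : ActionProfile n k, q * q :=
              Finset.sum_le_sum_of_subset_of_nonneg (Finset.erase_subset _ _)
                fun _ _ _ => mul_nonneg hq0 hq0
          _ = q := by
              rw [Finset.sum_const, nsmul_eq_mul, Finset.card_univ, ← mul_assoc, hAq, one_mul]
    refine (Finset.sum_le_sum fun a _ => h3 a).trans ?_
    rw [Finset.sum_const, nsmul_eq_mul, Finset.card_univ, ← mul_assoc, ← two_mul]
    rw [show (Fintype.card (ActionProfile n k) : ℝ) * (2 * q) = 2 by linarith]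
  -- For an integer `S`, `(S - 1)(S - 2) ≥ 0` gives `3S - S² ≤ 2`. With mean 1 and second moment at
  -- most 2, the left side averages at least 1.
  have h4 : ∑ W, (3 * S W - S W ^ 2) ≤
      ∑ W : LineWinners n k, 2 * (if ∃ a, W.IsSink a then (1 : ℝ) else 0) := by
    refine Finset.sum_le_sum fun W _ => ?_
    have hS : S W = ((Finset.univ.filter fun a => W.IsSink a).card : ℝ) := by simp [S]
    rw [hS]
    split_ifs with h
    · set c := (Finset.univ.filter fun a => W.IsSink a).card
      have h5 : (c : ℤ) ≤ 1 ∨ (2 : ℤ) ≤ c := by omega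
      have h6 : (0 : ℤ) ≤ ((c : ℤ) - 1) * (c - 2) := by
        rcases h5 with h5 | h5 <;> nlinarith
      have h7 : (0 : ℝ) ≤ ((c : ℝ) - 1) * (c - 2) := by exact_mod_cast h6
      nlinarith
    · rw [Finset.filter_eq_empty_iff.2 (fun a _ ha => h ⟨a, ha⟩)]
      simp
  rw [Finset.sum_sub_distrib, ← Finset.mul_sum, ← Finset.mul_sum, hind, h1] at h4
  by_contra! hc
  nlinarith

end LineWinners

end Sinks

/-! ### From random winners to random generic games -/

section GameWinners

namespace Game

variable {n : ℕ} {k : Fin n → ℕ}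

/-- The choice `W` consists of best-responses in the game `g`. -/
def HasWinners (g : Game n k) (W : LineWinners n k) : Prop :=
  ∀ i a, g.IsBestResponse i (W.winner i a) a

theorem isBestResponse_congr {g : Game n k} {i : Fin n} {x : Fin (k i)} {a b : ActionProfile n k}
    (h : ∀ j, j ≠ i → a j = b j) : g.IsBestResponse i x a ↔ g.IsBestResponse i x b := by
  have e : ∀ y : Fin (k i), Function.update a i y = Function.update b i y := by
    intro y
    ext j
    by_cases hj : j = i
    · subst hj; simp
    · simp [hj, h j hj]
  simp only [IsBestResponse, e]

theorem exists_isBestResponse (g : Game n k) {i : Fin n} (hi : 0 < k i) (a : ActionProfile n k) :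
    ∃ x, g.IsBestResponse i x a := by
  have : Nonempty (Fin (k i)) := ⟨⟨0, hi⟩⟩
  let r : Fin (k i) → Fin (k i) → Prop :=
    fun x y => g.pref i (Function.update a i y) (Function.update a i x)
  have : IsTrans (Fin (k i)) r := ⟨fun x y z h1 h2 => g.pref_trans _ _ _ _ h2 h1⟩
  have hd : Directed r (id : Fin (k i) → Fin (k i)) := by
    intro x y
    have hrefl : ∀ z, r z z := fun z => (g.pref_total i _ _).elim id id
    rcases g.pref_total i (Function.update a i x) (Function.update a i y) with h | h
    · exact ⟨x, hrefl x, h⟩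
    · exact ⟨y, h, hrefl y⟩
  obtain ⟨x, hx⟩ := hd.finite_le id
  exact ⟨x, hx⟩

theorem exists_hasWinners (hk : ∀ i, 2 ≤ k i) (g : Game n k) : ∃ W, g.HasWinners W := by
  have hpos : ∀ i, 0 < k i := fun i => by have := hk i; omega
  -- The action `0` in the line's own direction is arbitrary: best-responses do not depend on it.
  let base : GridLine n k → ActionProfile n k :=
    fun l j => if h : j = l.1 then ⟨0, hpos j⟩ else l.2 ⟨j, h⟩
  choose W hW using fun l : GridLine n k => g.exists_isBestResponse (hpos l.1) (base l)
  refine ⟨W, fun i a => (isBestResponse_congr fun j hj => ?_).1 (hW (lineThrough i a))⟩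
  exact dif_neg hj

theorem IsGeneric.isBestResponse_unique {g : Game n k} (hg : g.IsGeneric) {i : Fin n}
    {x y : Fin (k i)} {a : ActionProfile n k} (hx : g.IsBestResponse i x a)
    (hy : g.IsBestResponse i y a) : x = y := by
  by_contra hxy
  rcases hg i (Function.update a i x) (Function.update a i y)
    (fun h => hxy (Function.update_injective a i h)) (fun j hj => by simp [hj]) with h | h
  · exact h.2 (hy x)
  · exact h.2 (hx y)

theorem IsGeneric.isBestResponse_iff {g : Game n k} (hg : g.IsGeneric) {W : LineWinners n k}
    (hW : g.HasWinners W) {i : Fin n} {x : Fin (k i)} {a : ActionProfile n k} :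
    g.IsBestResponse i x a ↔ W.winner i a = x :=
  ⟨fun h => hg.isBestResponse_unique (hW i a) h, fun h => h ▸ hW i a⟩

theorem IsGeneric.hasWinners_unique {g : Game n k} (hg : g.IsGeneric) {W W' : LineWinners n k}
    (hW : g.HasWinners W) (hW' : g.HasWinners W') (hk : ∀ i, 2 ≤ k i) : W = W' := by
  have hpos : ∀ i, 0 < k i := fun i => by have := hk i; omega
  ext l
  obtain ⟨i, p⟩ := l
  let a : ActionProfile n k := fun j => if h : j = i then ⟨0, hpos j⟩ else p ⟨j, h⟩
  have hl : (⟨i, p⟩ : GridLine n k) = lineThrough i a := by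
    unfold lineThrough
    congr 1
    ext j
    simp [a, j.2]
  rw [hl]
  exact congrArg Fin.val (hg.isBestResponse_unique (hW i a) (hW' i a))

theorem IsGeneric.adj_iff {g : Game n k} (hg : g.IsGeneric) {W : LineWinners n k}
    (hW : g.HasWinners W) {a b : ActionProfile n k} :
    g.bestResponseGraph.Adj a b ↔ W.Adj a b := by
  constructor
  · rintro ⟨i, hab, hb, hs⟩
    rw [hg.isBestResponse_iff hW] at hb
    have e : b = Function.update a i (W.winner i a) := by
      ext j
      by_cases hj : j = i
      · subst hj; simp [hb]
      · simp [hj, hab j hj]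
    refine ⟨i, fun h => ?_, e⟩
    rw [h, Function.update_eq_self] at e
    rw [e] at hs
    exact hs.2 hs.1
  · rintro ⟨i, h, rfl⟩
    have hb : g.IsBestResponse i (Function.update a i (W.winner i a) i) a := by
      rw [Function.update_self]
      exact hW i a
    refine ⟨i, fun j hj => by simp [hj], hb, ?_⟩
    rcases hg i (Function.update a i (W.winner i a)) a
      (fun e => h (by simpa using congrFun e i)) (fun j hj => by simp [hj]) with hs | hs
    · exact hs
    · have := hb (a i)
      rw [Function.update_self, Function.update_eq_self] at this
      exact absurd this hs.2

theorem IsGeneric.isSinkVertex_iff {g : Game n k} (hg : g.IsGeneric) {W : LineWinners n k}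
    (hW : g.HasWinners W) {a : ActionProfile n k} :
    g.bestResponseGraph.IsSinkVertex a ↔ W.IsSink a := by
  simp only [Digraph.IsSinkVertex, hg.adj_iff hW, LineWinners.Adj, LineWinners.IsSink]
  constructor
  · intro h i
    by_contra hi
    exact h _ ⟨i, hi, rfl⟩
  · rintro h b ⟨i, hi, -⟩
    exact hi (h i)

theorem IsGeneric.canReach_iff {g : Game n k} (hg : g.IsGeneric) {W : LineWinners n k}
    (hW : g.HasWinners W) {a b : ActionProfile n k} :
    g.bestResponseGraph.CanReach a b ↔ W.Reach a b := by
  have : g.bestResponseGraph.Adj = W.Adj := by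
    ext a b
    exact hg.adj_iff hW
  unfold Digraph.CanReach LineWinners.Reach
  rw [this]

theorem IsGeneric.isPureNash_iff {g : Game n k} (hg : g.IsGeneric) {W : LineWinners n k}
    (hW : g.HasWinners W) {a : ActionProfile n k} : g.IsPureNash a ↔ W.IsSink a :=
  forall_congr' fun _ => hg.isBestResponse_iff hW

theorem IsGeneric.exists_misses {g : Game n k} (hg : g.IsGeneric) {W : LineWinners n k}
    (hW : g.HasWinners W) (hN : ∃ a, g.IsPureNash a) (hc : ¬ g.IsConnected) :
    ∃ w, W.IsSink w ∧ W.Misses w := by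
  obtain ⟨a, ha⟩ := hN
  have h1 : ∃ v, g.bestResponseGraph.IsSinkVertex v :=
    ⟨a, (hg.isSinkVertex_iff hW).2 ((hg.isPureNash_iff hW).1 ha)⟩
  by_contra hno
  refine hc ⟨h1, fun v w hv hw => by_contra fun hr => hno ?_⟩
  rw [hg.isSinkVertex_iff hW] at hv hw
  rw [hg.canReach_iff hW] at hr
  exact ⟨w, hw, v, hv, hr⟩

/-- Interchange the winners of `W` and `W'` on the line in direction `i` through `a`. -/
def swapWinners (W W' : LineWinners n k) (i : Fin n) (a : ActionProfile n k) :
    ActionProfile n k :=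
  Function.update a i (Equiv.swap (W.winner i a) (W'.winner i a) (a i))

theorem swapWinners_update (W W' : LineWinners n k) (i : Fin n) (a : ActionProfile n k)
    (x : Fin (k i)) : swapWinners W W' i (Function.update a i x) =
      Function.update a i (Equiv.swap (W.winner i a) (W'.winner i a) x) := by
  simp [swapWinners, LineWinners.winner_update]

theorem swapWinners_swapWinners (W W' : LineWinners n k) (i : Fin n) (a : ActionProfile n k) :
    swapWinners W W' i (swapWinners W W' i a) = a := by
  conv_lhs => rw [swapWinners.eq_def W W' i a]
  rw [swapWinners_update, Equiv.swap_apply_self, Function.update_eq_self]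

/-- The game in which every player's actions are relabelled, line by line, so as to interchange
the winners of `W` and `W'`. -/
def relabel (W W' : LineWinners n k) (g : Game n k) : Game n k where
  pref i a b := g.pref i (swapWinners W W' i a) (swapWinners W W' i b)
  pref_total i _ _ := g.pref_total i _ _
  pref_trans i _ _ _ := g.pref_trans i _ _ _

theorem relabel_relabel (W W' : LineWinners n k) (g : Game n k) :
    relabel W W' (relabel W W' g) = g := by
  obtain ⟨p, _, _⟩ := g
  simp [relabel, swapWinners_swapWinners]

theorem IsGeneric.relabel {g : Game n k} (hg : g.IsGeneric) (W W' : LineWinners n k) :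
    (relabel W W' g).IsGeneric := by
  intro i a b hab h
  refine hg i (swapWinners W W' i a) (swapWinners W W' i b) (fun e => hab ?_) (fun j hj => ?_)
  · rw [← swapWinners_swapWinners W W' i a, e, swapWinners_swapWinners]
  · simp [swapWinners, hj, h j hj]

theorem HasWinners.relabel {g : Game n k} {W : LineWinners n k} (hW : g.HasWinners W)
    (W' : LineWinners n k) : (relabel W W' g).HasWinners W' := by
  intro i a y
  change g.pref i (swapWinners W W' i _) (swapWinners W W' i _)
  rw [swapWinners_update, swapWinners_update, Equiv.swap_apply_right]
  exact hW i a _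

/-- Relabelling is an involution on games that turns winners `W` into `W'`. By symmetry all fibres
have equal size. -/
theorem ncard_hasWinners_le (W W' : LineWinners n k) :
    {g : Game n k | g.IsGeneric ∧ g.HasWinners W}.ncard ≤
      {g : Game n k | g.IsGeneric ∧ g.HasWinners W'}.ncard := by
  refine Set.ncard_le_ncard_of_injOn (relabel W W')
    (fun g hg => ⟨hg.1.relabel W W', hg.2.relabel W'⟩) ?_ (Set.toFinite _)
  exact (Function.LeftInverse.injective (relabel_relabel W W')).injOn

/-- The winners of a uniformly random generic game are uniformly distributed. -/
theorem exists_ncard_eq_mul_uniformProb (hk : ∀ i, 2 ≤ k i) :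
    ∃ N : ℝ, 0 ≤ N ∧ ∀ E : LineWinners n k → Prop,
      ({g : Game n k | g.IsGeneric ∧ ∃ W, g.HasWinners W ∧ E W}.ncard : ℝ) =
        N * uniformProb E := by
  classical
  obtain ⟨W₀⟩ := LineWinners.nonempty hk
  have : Nonempty (LineWinners n k) := ⟨W₀⟩
  have : Fintype (Game n k) := Fintype.ofFinite _
  refine ⟨({g : Game n k | g.IsGeneric ∧ g.HasWinners W₀}.ncard : ℝ) *
    Fintype.card (LineWinners n k), by positivity, fun E => ?_⟩
  have hpos : (0 : ℝ) < Fintype.card (LineWinners n k) := by exact_mod_cast Fintype.card_pos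
  rw [uniformProb_eq, mul_assoc, mul_div_cancel₀ _ hpos.ne']
  have h1 : {g : Game n k | g.IsGeneric ∧ ∃ W, g.HasWinners W ∧ E W} =
      ((Finset.univ.filter E).biUnion fun W =>
        Finset.univ.filter fun g : Game n k => g.IsGeneric ∧ g.HasWinners W : Finset (Game n k)) := by
    ext g
    simp only [Set.mem_ofPred_eq, Finset.coe_biUnion, Finset.coe_filter, Finset.mem_univ, true_and,
      Set.mem_iUnion, exists_prop]
    exact ⟨fun ⟨hg, W, hW, hE⟩ => ⟨W, hE, hg, hW⟩, fun ⟨W, hE, hg, hW⟩ => ⟨hg, W, hW, hE⟩⟩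
  have h2 : ∀ W, (Finset.univ.filter fun g : Game n k => g.IsGeneric ∧ g.HasWinners W).card =
      {g : Game n k | g.IsGeneric ∧ g.HasWinners W₀}.ncard := by
    intro W
    rw [← Set.ncard_coe_finset]
    simp only [Finset.coe_filter, Finset.mem_univ, true_and]
    exact le_antisymm (ncard_hasWinners_le W W₀) (ncard_hasWinners_le W₀ W)
  rw [h1, Set.ncard_coe_finset, Finset.card_biUnion, Finset.sum_congr rfl fun W _ => h2 W,
    Finset.sum_const, smul_eq_mul, Nat.cast_mul, mul_comm]
  intro W _ W' _ hWW
  rw [Function.onFun, Finset.disjoint_left]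
  intro g hg hg'
  simp only [Finset.mem_filter, Finset.mem_univ, true_and] at hg hg'
  exact hWW (hg.1.hasWinners_unique hg.2 hg'.2 hk)

/-- Few generic games with a pure Nash equilibrium fail to be connected. -/
theorem ncard_not_isConnected_le (hk : ∀ i, 2 ≤ k i) {β : ℝ}
    (hβ : ∀ w, uniformProb (fun W : LineWinners n k => W.HasStrandedVertex w) ≤ β) :
    ({g ∈ genericNashGames n k | ¬ g.IsConnected}.ncard : ℝ) ≤
      2 * β * (genericNashGames n k).ncard := by
  obtain ⟨N, hN, h⟩ := exists_ncard_eq_mul_uniformProb hk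
  have h1 : genericNashGames n k =
      {g : Game n k | g.IsGeneric ∧ ∃ W, g.HasWinners W ∧ ∃ a, W.IsSink a} := by
    ext g
    refine and_congr_right fun hg => ?_
    obtain ⟨W, hW⟩ := exists_hasWinners hk g
    constructor
    · rintro ⟨a, ha⟩
      exact ⟨W, hW, a, (hg.isPureNash_iff hW).1 ha⟩
    · rintro ⟨W', hW', a, ha⟩
      exact ⟨a, (hg.isPureNash_iff hW').2 ha⟩
  have h2 : {g ∈ genericNashGames n k | ¬ g.IsConnected} ⊆
      {g : Game n k | g.IsGeneric ∧ ∃ W, g.HasWinners W ∧ ∃ w, W.IsSink w ∧ W.Misses w} := by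
    rintro g ⟨⟨hg, hN⟩, hc⟩
    obtain ⟨W, hW⟩ := exists_hasWinners hk g
    exact ⟨hg, W, hW, hg.exists_misses hW hN hc⟩
  have h3 : ({g ∈ genericNashGames n k | ¬ g.IsConnected}.ncard : ℝ) ≤ N * β := by
    refine (Nat.cast_le.2 (Set.ncard_le_ncard h2 (Set.toFinite _))).trans ?_
    rw [h]
    gcongr
    exact LineWinners.uniformProb_exists_isSink_and_misses_le hk hβ
  have h4 : N * (1 / 2) ≤ (genericNashGames n k).ncard := by
    rw [h1, h]
    gcongr
    exact LineWinners.half_le_uniformProb_exists_isSink hk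
  have hβ0 : 0 ≤ β := by
    have hw : ActionProfile n k := fun i => ⟨0, by have := hk i; omega⟩
    exact (uniformProb_nonneg _).trans (hβ hw)
  nlinarith

end Game

end GameWinners

/-! ### Choice of parameters and conclusion -/

theorem uniformProb_hasStrandedVertex_le_of_sqrt {n : ℕ} {k : Fin n → ℕ} (hk : ∀ i, 2 ≤ k i)
    (hn : 4 ≤ n) (hK : ∀ i, (k i : ℝ) ≤ 1 / 10 * Real.sqrt ((n : ℝ) / Real.log (n : ℝ)))
    (w : ActionProfile n k) :
    uniformProb (fun W : LineWinners n k => W.HasStrandedVertex w) ≤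
      (Real.exp (1 / n) - 1) + 1 / n := by
  have hn4 : (4 : ℝ) ≤ n := by exact_mod_cast hn
  have hn0 : (0 : ℝ) < n := by linarith
  have hlog : 1 ≤ Real.log n := by
    rw [Real.le_log_iff_exp_le hn0]
    linarith [Real.exp_one_lt_d9]
  set K : ℝ := 1 / 10 * Real.sqrt ((n : ℝ) / Real.log (n : ℝ)) with hKdef
  have hK2 : K ^ 2 = 1 / 100 * ((n : ℝ) / Real.log n) := by
    rw [hKdef, mul_pow, Real.sq_sqrt (by positivity)]
    norm_num
  have hK0 : 0 ≤ K := by positivity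
  have hKn : K ≤ n := by
    refine abs_le_of_sq_le_sq' ?_ hn0.le |>.2
    rw [hK2]
    have : (n : ℝ) / Real.log n ≤ n := div_le_self hn0.le hlog
    nlinarith
  -- The constant `1/10` makes `n/(4K²) = 25 log n`, so a route is blocked with probability at most
  -- `n⁻²⁴ = r⁸` for `r = n⁻³`, and `n K r ≤ 1/n`.
  have hexp : Real.exp (-(n / (4 * K ^ 2))) = ((n : ℝ)⁻¹) ^ 25 := by
    have : -((n : ℝ) / (4 * K ^ 2)) = (25 : ℕ) * (-Real.log n) := by
      rw [hK2]
      field_simp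
      norm_num
    rw [this, Real.exp_nat_mul, Real.exp_neg, Real.exp_log hn0]
  have hinv0 : (0 : ℝ) ≤ (n : ℝ)⁻¹ := by positivity
  have hinv1 : (n : ℝ)⁻¹ ≤ 1 := inv_le_one_of_one_le₀ (by linarith)
  have hmul : (n : ℝ) * (n : ℝ)⁻¹ = 1 := mul_inv_cancel₀ hn0.ne'
  have h := LineWinners.uniformProb_hasStrandedVertex_le hk hK hn (r := ((n : ℝ)⁻¹) ^ 3)
    (by positivity) (pow_le_one₀ hinv0 hinv1) (by
      rw [hexp]
      refine le_of_eq ?_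
      calc (n : ℝ) * ((n : ℝ)⁻¹) ^ 25 = (n * (n : ℝ)⁻¹) * ((n : ℝ)⁻¹) ^ 24 := by ring
        _ = _ := by rw [hmul, one_mul, ← pow_mul]) w
  refine h.trans (add_le_add (sub_le_sub_right (Real.exp_le_exp.2 ?_) _) ?_)
  · calc (n : ℝ) * K * (n : ℝ)⁻¹ ^ 3 ≤ n * n * (n : ℝ)⁻¹ ^ 3 := by gcongr
      _ = (n * (n : ℝ)⁻¹) ^ 2 * (n : ℝ)⁻¹ := by ring
      _ = 1 / n := by rw [hmul, one_pow, one_mul, one_div]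
  · calc (n : ℝ) * K * ((n : ℝ)⁻¹ ^ 3) ^ 8 ≤ n * n * ((n : ℝ)⁻¹ ^ 3) ^ 8 := by gcongr
      _ = (n * (n : ℝ)⁻¹) ^ 2 * ((n : ℝ)⁻¹ * (n : ℝ)⁻¹ ^ 21) := by ring
      _ ≤ (n * (n : ℝ)⁻¹) ^ 2 * ((n : ℝ)⁻¹ * 1) := by
          gcongr
          exact pow_le_one₀ hinv0 hinv1
      _ = 1 / n := by rw [hmul, one_pow, one_mul, mul_one, one_div]

/-- A class of generic games with a pure Nash equilibrium of relative density at least `p` consists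
mostly of connected games. -/
theorem one_sub_le_ncard_isConnected_div {n : ℕ} {k : Fin n → ℕ} (hk : ∀ i, 2 ≤ k i) {β p : ℝ}
    (hβ : ∀ w, uniformProb (fun W : LineWinners n k => W.HasStrandedVertex w) ≤ β) (hp : 0 < p)
    {X : Set (Game n k)} (hX : X ⊆ genericNashGames n k)
    (hpX : p ≤ (X.ncard : ℝ) / ((genericNashGames n k).ncard : ℝ)) :
    1 - 2 * β / p ≤ (({g ∈ X | g.IsConnected}).ncard : ℝ) / (X.ncard : ℝ) := by
  have hN : (0 : ℝ) < (genericNashGames n k).ncard := by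
    -- Division by zero gives `0`, so `0 < p` excludes an empty set of reference games.
    rcases (Nat.cast_nonneg (α := ℝ) (genericNashGames n k).ncard).eq_or_lt with h | h
    · rw [← h, div_zero] at hpX
      linarith
    · exact h
  have hXN : p * (genericNashGames n k).ncard ≤ X.ncard := (le_div_iff₀ hN).1 hpX
  have hX0 : (0 : ℝ) < X.ncard := lt_of_lt_of_le (by positivity) hXN
  have hbad : ({g ∈ X | ¬ g.IsConnected}.ncard : ℝ) ≤ 2 * β * (genericNashGames n k).ncard := by
    refine (Nat.cast_le.2 (Set.ncard_le_ncard ?_ (Set.toFinite _))).trans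
      (Game.ncard_not_isConnected_le hk hβ)
    exact fun g hg => ⟨hX hg.1, hg.2⟩
  have hsplit : (X.ncard : ℝ) ≤
      ({g ∈ X | g.IsConnected}.ncard : ℝ) + ({g ∈ X | ¬ g.IsConnected}.ncard : ℝ) := by
    have h : X ⊆ {g ∈ X | g.IsConnected} ∪ {g ∈ X | ¬ g.IsConnected} := fun g hg =>
      (em g.IsConnected).imp (⟨hg, ·⟩) (⟨hg, ·⟩)
    exact_mod_cast (Set.ncard_le_ncard h (Set.toFinite _)).trans (Set.ncard_union_le _ _)
  have hβ0 : 0 ≤ β := by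
    have hw : ActionProfile n k := fun i => ⟨0, by have := hk i; omega⟩
    exact (uniformProb_nonneg _).trans (hβ hw)
  rw [le_div_iff₀ hX0]
  have h1 : 2 * β * (genericNashGames n k).ncard ≤ 2 * β / p * X.ncard := by
    calc _ = 2 * β / p * (p * (genericNashGames n k).ncard) := by field_simp
      _ ≤ _ := by gcongr
  linarith

theorem corollary1 :
    ∃ δ : ℝ, 0 < δ ∧
      ∀ k : (n : ℕ) → Fin n → ℕ,
        (∀ n i, 2 ≤ k n i) →
        (∀ᶠ n : ℕ in atTop, ∀ i, (k n i : ℝ) ≤ δ * Real.sqrt ((n : ℝ) / Real.log (n : ℝ))) →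
        ∀ X : (n : ℕ) → Set (Game n (k n)),
          (∀ n, X n ⊆ genericNashGames n (k n)) →
          HasPositiveAsymptoticDensity k X →
          Tendsto
            (fun n : ℕ => (({g ∈ X n | g.IsConnected}).ncard : ℝ) / ((X n).ncard : ℝ))
            atTop (𝓝 1) := by
  refine ⟨1 / 10, by norm_num, fun k hk hK X hX ⟨p, hp, _, hpX⟩ => ?_⟩
  have hlim : Tendsto (fun n : ℕ => 1 - 2 * ((Real.exp (1 / n) - 1) + 1 / n) / p) atTop (𝓝 1) := by
    have h1 : Tendsto (fun n : ℕ => (1 : ℝ) / n) atTop (𝓝 0) := tendsto_one_div_atTop_nhds_zero_nat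
    have h2 : Tendsto (fun n : ℕ => Real.exp (1 / n)) atTop (𝓝 1) := by
      simpa [Function.comp_def] using (Real.continuous_exp.tendsto 0).comp h1
    have h3 := tendsto_const_nhds (x := (1 : ℝ)) (f := atTop (α := ℕ)) |>.sub
      ((((h2.sub_const 1).add h1).const_mul 2).div_const p)
    simpa using h3
  refine tendsto_of_tendsto_of_tendsto_of_le_of_le' hlim tendsto_const_nhds ?_ ?_
  · filter_upwards [hK, hpX, eventually_ge_atTop 4] with n hKn hpn hn
    exact one_sub_le_ncard_isConnected_div (hk n)
      (uniformProb_hasStrandedVertex_le_of_sqrt (hk n) hn hKn) hp (hX n) hpn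
  · refine Eventually.of_forall fun n => div_le_one_of_le₀ ?_ (Nat.cast_nonneg _)
    exact Nat.cast_le.2 (Set.ncard_le_ncard (Set.sep_subset _ _) (Set.toFinite _))
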